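/- Let $K$ be a field and let $S=K[x_1,\dots,x_m,y_1,\dots,y_n]$ ($m,n\ge 0$) be the bigraded polynomial ring with $\deg x_i=(1,0)$ and $\deg y_j=(0,1)$; put $Q=(y_1,\dots,y_n)$. For a finitely generated bigraded ($\mathbb Z^2$-graded) $S$-module $M$ let $H^i_Q(M)$ be the local cohomology modules of $M$ with support in $Q$, and let $\operatorname{cd}(Q,M)$ be the largest integer $i$ with $H^i_Q(M)\neq 0$ ($-\infty$ if $M=0$). $M$ is called Cohen–Macaulay with respect to $Q$ if there is $q\in\mathbb Z$ with $H^i_Q(M)=0$ for all $i\ne q$. $M$ is called sequentially Cohen–Macaulay with respect to $Q$ if there is a finite filtration $0=M_0\subsetneq M_1\subsetneq\dots\subsetneq M_r=M$ ($r\ge 0$) by bigraded submodules such that each quotient $M_i/M_{i-1}$ is Cohen–Macaulay with respect to $Q$ and $0\le \operatorname{cd}(Q,M_1/M_0)<\operatorname{cd}(Q,M_2/M_1)<\dots<\operatorname{cd}(Q,M_r/M_{r-1})$. $M$ is called relatively unmixed with respect to $Q$ if $\operatorname{cd}(Q,M)=\operatorname{cd}(Q,S/\mathfrak p)$ for all $\mathfrak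 p\in\operatorname{Ass}(M)$. (1) Let $M$ be a finitely generated bigraded $S$-module. If $M$ is sequentially Cohen–Macaulay with respect to $Q$ and relatively unmixed with respect to $Q$, then $M$ is Cohen–Macaulay with respect to $Q$. (2) In particular, unmixed sequentially Cohen–Macaulay modules are Cohen–Macaulay. That is: let $R$ be a polynomial ring over $K$ in finitely many variables with the standard grading, let $\mathfrak m$ be the ideal generated by the variables, and call a finitely generated graded ($\mathbb Z$-graded) $R$-module $N$ Cohen–Macaulay if $\operatorname{depth}N=\dim N$, where $\operatorname{depth} N$ is the largest length of an $N$-regular sequence in $\mathfrak m$ (the zero module counts as Cohen–Macaulay). Let $M$ be a finitely generated graded $R$-module which is unmixed, i.e. $\dim R/\mathfrak p=\dim M$ for all $\mathfrak p\in\operatorname{Ass}(M)$, and sequentially Cohen–Macaulay, i.e. there is a finite filtration $0=M_0\subsetneq M_1\subsetneq\dots\subsetneq M_r=M$ by graded submodules whose quotients $M_i/M_{i-1}$ are Cohen–Macaulay with $\dim M_1/M_0<\dots<\dim M_r/M_{r-1}$. Then $M$ is Cohen–Macaulay. -/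

import Mathlib

universe u v w

noncomputable section

open CategoryTheory

namespace BigradedCM

/-! ### The bigraded polynomial ring -/

/-- The polynomial ring `S = K[x₁, …, x_m, y₁, …, y_n]`;
`Sum.inl` indexes the `x`-variables and `Sum.inr` the `y`-variables. -/
abbrev BiPoly (K : Type u) [Field K] (m n : ℕ) : Type u :=
  MvPolynomial (Fin m ⊕ Fin n) K

/-- The bidegrees of the variables: `deg xᵢ = (1, 0)` and `deg yⱼ = (0, 1)`. -/
def bidegree (m n : ℕ) : Fin m ⊕ Fin n → ℤ × ℤ :=
  Sum.elim (fun _ => (1, 0)) (fun _ => (0, 1))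

/-- The standard bigrading of `S`, indexed by `ℤ × ℤ` (the components with a negative
index vanish). -/
abbrev biPolyGrading (K : Type u) [Field K] (m n : ℕ) : ℤ × ℤ → Submodule K (BiPoly K m n) :=
  MvPolynomial.weightedHomogeneousSubmodule K (bidegree m n)

/-- The bigraded irrelevant ideal `Q = (y₁, …, y_n)` of `S`. -/
def idealQ (K : Type u) [Field K] (m n : ℕ) : Ideal (BiPoly K m n) :=
  Ideal.span (Set.range fun j : Fin n => MvPolynomial.X (Sum.inr j))

/-! ### Cohomological dimension and Cohen-Macaulayness with respect to an ideal -/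

section Relative

variable {S : Type u} [CommRing S] (Q : Ideal S)

/-- `H^i_Q(M) = 0`. -/
def LocalCohomologyVanishes (i : ℕ) (M : Type u) [AddCommGroup M] [Module S M] : Prop :=
  Limits.IsZero ((localCohomology Q i).obj (ModuleCat.of S M))

/-- The cohomological dimension `cd(Q, M)`, the largest `i` with `H^i_Q(M) ≠ 0`
(equal to `⊥ = -∞` when there is no such `i`). -/
def cohomDim (M : Type u) [AddCommGroup M] [Module S M] : WithBot ℕ∞ :=
  ⨆ (i : ℕ) (_ : ¬ LocalCohomologyVanishes Q i M), ((i : ℕ∞) : WithBot ℕ∞)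

/-- `M` is Cohen-Macaulay with respect to `Q`: for some `q ∈ ℤ` one has
`H^i_Q(M) = 0` for all `i ≠ q`. -/
def IsCMWrt (M : Type u) [AddCommGroup M] [Module S M] : Prop :=
  ∃ q : ℤ, ∀ i : ℕ, (i : ℤ) ≠ q → LocalCohomologyVanishes Q i M

/-- `M` is relatively unmixed with respect to `Q`:
`cd(Q, M) = cd(Q, S/𝔭)` for all `𝔭 ∈ Ass(M)`. -/
def IsRelativelyUnmixed (M : Type u) [AddCommGroup M] [Module S M] : Prop :=
  ∀ p ∈ associatedPrimes S M, cohomDim Q M = cohomDim Q (S ⧸ p)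

end Relative

/-! ### Filtrations by homogeneous submodules -/

section Filtration

variable {S : Type v} [CommRing S] {M : Type w} [AddCommGroup M] [Module S M]

/-- `F` is a finite filtration `0 = M₀ ⊊ M₁ ⊊ ⋯ ⊊ M_r = M` of the graded module `M` by
homogeneous submodules. -/
structure IsHomogeneousFiltration {ι : Type*} [DecidableEq ι] (𝓜 : ι → AddSubgroup M)
    [DirectSum.Decomposition 𝓜] {r : ℕ} (F : Fin (r + 1) → Submodule S M) : Prop where
  bot : F 0 = ⊥
  top : F (Fin.last r) = ⊤
  strictMono : StrictMono F
  homogeneous : ∀ i, (F i).IsHomogeneous 𝓜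

/-- The `i`-th quotient `M_{i+1} / M_i` of a filtration (`0 ≤ i < r`). -/
abbrev filtrationQuotient {r : ℕ} (F : Fin (r + 1) → Submodule S M) (i : Fin r) : Type w :=
  ↥(F i.succ) ⧸ (F i.castSucc).submoduleOf (F i.succ)

end Filtration

/-- `F` is a Cohen-Macaulay filtration of the graded module `M` with respect to `Q`. -/
structure IsCMFiltrationWrt {S : Type u} [CommRing S] (Q : Ideal S)
    {M : Type u} [AddCommGroup M] [Module S M]
    {ι : Type*} [DecidableEq ι] (𝓜 : ι → AddSubgroup M) [DirectSum.Decomposition 𝓜]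
    {r : ℕ} (F : Fin (r + 1) → Submodule S M) : Prop
    extends IsHomogeneousFiltration 𝓜 F where
  isCM : ∀ i, IsCMWrt Q (filtrationQuotient F i)
  cohomDim_nonneg : ∀ i, 0 ≤ cohomDim Q (filtrationQuotient F i)
  cohomDim_strictMono : StrictMono fun i => cohomDim Q (filtrationQuotient F i)

/-- The graded module `M` is sequentially Cohen-Macaulay with respect to `Q`:
it admits a Cohen-Macaulay filtration with respect to `Q`. -/
def IsSeqCMWrt {S : Type u} [CommRing S] (Q : Ideal S)
    {M : Type u} [AddCommGroup M] [Module S M]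
    {ι : Type*} [DecidableEq ι] (𝓜 : ι → AddSubgroup M) [DirectSum.Decomposition 𝓜] : Prop :=
  ∃ (r : ℕ) (F : Fin (r + 1) → Submodule S M), IsCMFiltrationWrt Q 𝓜 F

/-! ### The classical notions for graded modules over a standard graded polynomial ring -/

section Ordinary

variable (K : Type u) [Field K] (σ : Type v)

/-- The standard grading of `K[z_s : s ∈ σ]`, every variable having degree `1`, indexed by `ℤ`. -/
abbrev stdGrading : ℤ → Submodule K (MvPolynomial σ K) :=
  MvPolynomial.weightedHomogeneousSubmodule K (fun _ : σ => (1 : ℤ))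

/-- The graded maximal ideal, generated by all variables. -/
def irrelevantIdeal : Ideal (MvPolynomial σ K) :=
  Ideal.span (Set.range MvPolynomial.X)

/-- The depth of `M`: the largest length of an `M`-regular sequence contained in the graded
maximal ideal (equal to `⊥` for the zero module). -/
def gradedDepth (M : Type w) [AddCommGroup M] [Module (MvPolynomial σ K) M] : WithBot ℕ∞ :=
  ⨆ (rs : List (MvPolynomial σ K))
    (_ : (∀ f ∈ rs, f ∈ irrelevantIdeal K σ) ∧ RingTheory.Sequence.IsRegular M rs),
    ((rs.length : ℕ∞) : WithBot ℕ∞)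

/-- A finitely generated graded module is Cohen-Macaulay if its depth equals its Krull
dimension (the zero module is Cohen-Macaulay, both sides being `⊥`). -/
def IsCM (M : Type w) [AddCommGroup M] [Module (MvPolynomial σ K) M] : Prop :=
  gradedDepth K σ M = Module.supportDim (MvPolynomial σ K) M

/-- `M` is unmixed: `dim S/𝔭 = dim M` for all `𝔭 ∈ Ass(M)`. -/
def IsUnmixed (M : Type w) [AddCommGroup M] [Module (MvPolynomial σ K) M] : Prop :=
  ∀ p ∈ associatedPrimes (MvPolynomial σ K) M,
    Module.supportDim (MvPolynomial σ K) M = ringKrullDim (MvPolynomial σ K ⧸ p)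

/-- The graded module `M` is sequentially Cohen-Macaulay: it has a finite filtration by graded
submodules with Cohen-Macaulay quotients of strictly increasing Krull dimension. -/
def IsSeqCM {M : Type w} [AddCommGroup M] [Module (MvPolynomial σ K) M]
    (𝓜 : ℤ → AddSubgroup M) [DirectSum.Decomposition 𝓜] : Prop :=
  ∃ (r : ℕ) (F : Fin (r + 1) → Submodule (MvPolynomial σ K) M),
    IsHomogeneousFiltration 𝓜 F ∧
    (∀ i, IsCM K σ (filtrationQuotient F i)) ∧
    StrictMono fun i => Module.supportDim (MvPolynomial σ K) (filtrationQuotient F i)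

end Ordinary

end BigradedCM

end

/-! Both parts show that the filtration has at most one step. If there are two or more, choose `p`
in Ass(M₁), hence in Ass(M). As S/p embeds in M₁, unmixedness bounds the dimension of M
(respectively cd) by that of M₁, which is strictly less than that of the top quotient M/M_{r-1}. But
the top quotient is an image of M, so its dimension is at most that of M: a contradiction.

For Krull dimension, monotonicity under submodules and quotients is standard. For cd it rests on
`LocalCohomologyVanishes.of_annihilator_le`: vanishing from degree q on depends only on the support.
That is a descending induction on the degree, started by `localCohomologyVanishes_idealQ`. Its long
exact sequence arguments go through `localCohomologyVanishes_iff_pow`, which describes vanishing by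
classes in `Abelian.Ext` of S/Q^k that die on S/Q^l. -/

open CategoryTheory Limits

namespace BigradedCM

/-! ### The two ends of a filtration. -/

section Filtration

variable {S : Type v} [CommRing S] {M : Type w} [AddCommGroup M] [Module S M]
  {ι : Type*} [DecidableEq ι] {𝓜 : ι → AddSubgroup M} [DirectSum.Decomposition 𝓜]

namespace IsHomogeneousFiltration

lemma subsingleton {F : Fin 1 → Submodule S M} (hF : IsHomogeneousFiltration 𝓜 F) :
    Subsingleton M := by
  have h : (⊥ : Submodule S M) = ⊤ := hF.bot.symm.trans hF.top
  exact (Submodule.subsingleton_iff S).1 (subsingleton_of_bot_eq_top h)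

lemma nontrivial_filtrationQuotient {r : ℕ} {F : Fin (r + 1) → Submodule S M}
    (hF : IsHomogeneousFiltration 𝓜 F) (i : Fin r) : Nontrivial (filtrationQuotient F i) := by
  rw [Submodule.Quotient.nontrivial_iff]
  intro h
  rw [Submodule.submoduleOf_eq_top] at h
  exact absurd (hF.strictMono i.castSucc_lt_succ) (not_lt_of_ge h)

/-- The first quotient of a filtration of positive length embeds into the module. -/
lemma exists_injective_first {r : ℕ} {F : Fin (r + 1 + 1) → Submodule S M}
    (hF : IsHomogeneousFiltration 𝓜 F) :
    ∃ f : filtrationQuotient F 0 →ₗ[S] M, Function.Injective f := by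
  have h : (F (Fin.castSucc 0)).submoduleOf (F (Fin.succ 0)) = ⊥ := by
    have : F (Fin.castSucc 0) = ⊥ := hF.bot
    rw [this]
    exact Submodule.ker_subtype _
  exact ⟨(F (Fin.succ 0)).subtype ∘ₗ (Submodule.quotEquivOfEqBot _ h).toLinearMap,
    (F (Fin.succ 0)).injective_subtype.comp (LinearEquiv.injective _)⟩

/-- The last quotient of a filtration of positive length is a quotient of the module. -/
lemma exists_surjective_last {r : ℕ} {F : Fin (r + 1 + 1) → Submodule S M}
    (hF : IsHomogeneousFiltration 𝓜 F) :
    ∃ f : M →ₗ[S] filtrationQuotient F (Fin.last r), Function.Surjective f := by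
  have h : F (Fin.succ (Fin.last r)) = ⊤ := hF.top
  refine ⟨Submodule.mkQ _ ∘ₗ (LinearEquiv.ofTop _ h).symm.toLinearMap, ?_⟩
  exact (Submodule.mkQ_surjective _).comp (LinearEquiv.surjective _)

/-- The only quotient of a filtration of length one is the module itself. -/
lemma nonempty_linearEquiv {F : Fin 2 → Submodule S M} (hF : IsHomogeneousFiltration 𝓜 F) :
    Nonempty (filtrationQuotient F 0 ≃ₗ[S] M) := by
  have h : (F (Fin.castSucc 0)).submoduleOf (F (Fin.succ 0)) = ⊥ := by
    have : F (Fin.castSucc 0) = ⊥ := hF.bot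
    rw [this]
    exact Submodule.ker_subtype _
  have h' : F (Fin.succ 0) = ⊤ := hF.top
  exact ⟨(Submodule.quotEquivOfEqBot _ h).trans (LinearEquiv.ofTop _ h')⟩

end IsHomogeneousFiltration

end Filtration

/-! ### The classical statement, by Krull dimension. -/

section Ordinary

variable {K : Type u} [Field K] {σ : Type v}

lemma isCM_of_linearEquiv {M N : Type w} [AddCommGroup M] [Module (MvPolynomial σ K) M]
    [AddCommGroup N] [Module (MvPolynomial σ K) N] (e : M ≃ₗ[MvPolynomial σ K] N)
    (h : IsCM K σ M) : IsCM K σ N := by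
  unfold IsCM gradedDepth at *
  rw [← Module.supportDim_eq_of_equiv e, ← h]
  simp only [e.isRegular_congr]

lemma isCM_of_subsingleton (M : Type w) [AddCommGroup M] [Module (MvPolynomial σ K) M]
    [Subsingleton M] : IsCM K σ M := by
  unfold IsCM gradedDepth
  rw [Module.supportDim_eq_bot_of_subsingleton, iSup₂_eq_bot]
  rintro rs ⟨-, h⟩
  have := h.nontrivial
  exact absurd ‹Subsingleton M› (not_subsingleton M)

/-- Unmixed sequentially Cohen-Macaulay graded modules are Cohen-Macaulay. -/
theorem isCM_of_isSeqCM_of_isUnmixed [Finite σ] {M : Type w} [AddCommGroup M]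
    [Module (MvPolynomial σ K) M]
    (𝓜 : ℤ → AddSubgroup M) [DirectSum.Decomposition 𝓜]
    (hM : IsSeqCM K σ 𝓜) (hu : IsUnmixed K σ M) : IsCM K σ M := by
  obtain ⟨r, F, hF, hCM, hdim⟩ := hM
  obtain _ | _ | r := r
  · have := hF.subsingleton
    exact isCM_of_subsingleton M
  · obtain ⟨e⟩ := hF.nonempty_linearEquiv
    exact isCM_of_linearEquiv e (hCM 0)
  -- With at least two steps: dim M_r/M_{r-1} ≤ dim M = dim R/p ≤ dim M₁, against strict growth.
  · obtain ⟨f, hf⟩ := hF.exists_injective_first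
    obtain ⟨g, hg⟩ := hF.exists_surjective_last
    have := hF.nontrivial_filtrationQuotient 0
    obtain ⟨p, hp⟩ := associatedPrimes.nonempty (MvPolynomial σ K) (filtrationQuotient F 0)
    obtain ⟨hprime, x, hx⟩ := (isAssociatedPrime_iff_exists_injective_linearMap _ _).1 hp
    have h1 := hu p (associatedPrimes.subset_of_injective hf hp)
    have h2 := Module.supportDim_le_of_injective x hx
    rw [Module.supportDim_quotient_eq_ringKrullDim, ← h1] at h2
    have h3 := (Module.supportDim_le_of_surjective g hg).trans h2
    exact absurd (hdim (show (0 : Fin (r + 2)) < Fin.last (r + 1) from Fin.last_pos))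
      (not_lt_of_ge h3)

end Ordinary
end BigradedCM

/-! ### Cocycles and coboundaries in complexes of modules. -/

namespace CochainComplex

variable {R : Type u} [Ring R] (K : CochainComplex (ModuleCat.{v} R) ℕ)

lemma exists_iCycles_eq {n : ℕ} (f : K.X n) (hf : K.d n (n + 1) f = 0) :
    ∃ z : K.cycles n, K.iCycles n z = f := by
  have hf' : (K.sc n).g f = 0 := by
    have : (ComplexShape.up ℕ).next n = n + 1 := by simp
    change K.d n ((ComplexShape.up ℕ).next n) f = 0
    rw [this]
    exact hf
  refine ⟨(K.sc n).moduleCatCyclesIso.inv ⟨f, hf'⟩, ?_⟩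
  exact ConcreteCategory.congr_hom (K.sc n).moduleCatCyclesIso_inv_iCycles (⟨f, hf'⟩)

lemma homologyπ_eq_zero_iff {n p : ℕ} (hp : (ComplexShape.up ℕ).prev n = p) (z : K.cycles n) :
    K.homologyπ n z = 0 ↔ ∃ g : K.X p, K.d p n g = K.iCycles n z := by
  have hex := (ShortComplex.ShortExact.moduleCat_exact_iff_function_exact _).1
    (ShortComplex.exact_of_g_is_cokernel (.mk _ _ (K.toCycles_comp_homologyπ p n))
      (K.homologyIsCokernel p n hp))
  have hinj : Function.Injective (K.iCycles n) :=
    (ModuleCat.mono_iff_injective _).1 inferInstance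
  refine (hex z).trans ?_
  simp only [Set.mem_range, ← hinj.eq_iff]
  refine exists_congr fun g => ?_
  rw [← K.toCycles_i p n]
  rfl

end CochainComplex

/-! ### Comparing the derived-functor `Ext` with `Abelian.Ext` through cocycles. -/

namespace CategoryTheory.ProjectiveResolution

section

variable {R : Type u} [Ring R] {C : Type w} [Category.{v} C] [Abelian C] [Linear R C]

/-- The map of cochain complexes `Hom(Q, Y) ⟶ Hom(P, Y)` induced by a chain map `P ⟶ Q`. -/
noncomputable def linearYonedaMap {P Q : ChainComplex C ℕ} (φ : P ⟶ Q) (Y : C) :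
    Q.linearYonedaObj R Y ⟶ P.linearYonedaObj R Y :=
  (HomologicalComplex.unopFunctor _ _).map
    ((((linearYoneda R C).obj Y).rightOp.mapHomologicalComplex _).map φ).op

/-- Two naturality squares are pasted after `unop`: that of left derived functors, and that of
homology of opposite complexes. -/
lemma Ext_map_comp_isoExt_hom [EnoughProjectives C] {X X' : C} (g : X' ⟶ X)
    (P : ProjectiveResolution X)
    (P' : ProjectiveResolution X') (φ : Hom P' P g) (n : ℕ) (Y : C) :
    ((Ext R C n).map g.op).app Y ≫ (P'.isoExt n Y).hom =
      (P.isoExt n Y).hom ≫ HomologicalComplex.homologyMap (linearYonedaMap φ.hom Y) n := by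
  have h := isoLeftDerivedObj_inv_naturality g P' P φ.hom
    (by simpa using φ.hom_f_zero_comp_π_f_zero)
    ((linearYoneda R C).obj Y).rightOp n
  have h' := ShortComplex.homologyOpIso_inv_naturality
    ((HomologicalComplex.shortComplexFunctor _ _ n).map (linearYonedaMap (R := R) φ.hom Y))
  have e : ((Ext R C n).map g.op).app Y =
    ((((linearYoneda R C).obj Y).rightOp.leftDerived n).map g).unop := rfl
  have e1 (Z : C) (P : ProjectiveResolution Z) : (P.isoExt (R := R) n Y).hom =
    (P.isoLeftDerivedObj ((linearYoneda R C).obj Y).rightOp n).inv.unop ≫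
      ((P.complex.linearYonedaObj R Y).homologyOp n).inv.unop := rfl
  rw [e, e1, e1]
  have h2 := congrArg Quiver.Hom.unop h
  have h3 := congrArg Quiver.Hom.unop h'
  rw [unop_comp, unop_comp] at h2 h3
  refine (reassoc_of% h2) _ |>.trans ?_
  exact (congrArg (fun t => (P.isoLeftDerivedObj ((linearYoneda R C).obj Y).rightOp n).inv.unop ≫ t)
    h3.symm).trans (Category.assoc _ _ _).symm

end

section

variable {R : Type u} [CommRing R] {X X' : ModuleCat.{u} R}

/-- `P.Represents f x` means that the cocycle `f` in `Hom(P, Y)` represents the class `x`. -/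
def Represents (P : ProjectiveResolution X) {n : ℕ} {Y : ModuleCat.{u} R}
    (f : P.complex.X n ⟶ Y) (x : ((Ext R (ModuleCat.{u} R) n).obj (Opposite.op X)).obj Y) : Prop :=
  ∃ z : (P.complex.linearYonedaObj R Y).cycles n,
    (P.complex.linearYonedaObj R Y).homologyπ n z = (P.isoExt n Y).hom x ∧
      (P.complex.linearYonedaObj R Y).iCycles n z = f

variable {P : ProjectiveResolution X} {n : ℕ} {Y : ModuleCat.{u} R}
  {f : P.complex.X n ⟶ Y} {x : ((Ext R (ModuleCat.{u} R) n).obj (Opposite.op X)).obj Y}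

lemma Represents.cocycle (h : P.Represents f x) : P.complex.d (n + 1) n ≫ f = 0 := by
  obtain ⟨z, -, rfl⟩ := h
  exact ConcreteCategory.congr_hom ((P.complex.linearYonedaObj R Y).iCycles_d n (n + 1)) z

lemma exists_represents (P : ProjectiveResolution X)
    (x : ((Ext R (ModuleCat.{u} R) n).obj (Opposite.op X)).obj Y) :
    ∃ f : P.complex.X n ⟶ Y, P.Represents f x := by
  have hs : Function.Surjective ((P.complex.linearYonedaObj R Y).homologyπ n) :=
    (ModuleCat.epi_iff_surjective _).1 inferInstance
  obtain ⟨z, hz⟩ := hs ((P.isoExt n Y).hom x)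
  exact ⟨_, z, hz, rfl⟩

lemma exists_represents_of_cocycle (f : P.complex.X n ⟶ Y) (hf : P.complex.d (n + 1) n ≫ f = 0) :
    ∃ x, P.Represents f x := by
  obtain ⟨z, hz⟩ := (P.complex.linearYonedaObj R Y).exists_iCycles_eq f hf
  refine ⟨(P.isoExt n Y).inv ((P.complex.linearYonedaObj R Y).homologyπ n z), z, ?_, hz⟩
  simp

/-- The resolution vanishes in cochain degree 1, so the only coboundary in degree zero is zero.
`extMk_eq_zero_iff` covers only degrees with a predecessor. -/
lemma extMk_zero_eq_zero_iff (f : P.complex.X 0 ⟶ Y) (hf : P.complex.d 1 0 ≫ f = 0) :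
    P.extMk f 1 rfl hf = 0 ↔ f = 0 := by
  refine ⟨fun h => ?_, fun h => by subst h; simp⟩
  simp only [← P.extEquivCohomologyClass.apply_eq_iff_eq,
    extEquivCohomologyClass_extMk, extEquivCohomologyClass_zero,
    CochainComplex.HomComplex.CohomologyClass.mk_eq_zero_iff] at h
  rw [CochainComplex.HomComplex.Cocycle.toSingleMk_mem_coboundaries_iff _ _ _ _ _ 1 (by lia)] at h
  obtain ⟨g, hg⟩ := h
  have h0 : P.cochainComplex.d (-0) 1 = 0 := by
    exact (CochainComplex.isZero_of_isStrictlyLE _ 0 _ (by lia)).eq_of_tgt _ _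
  change P.cochainComplex.d (-0) 1 ≫ g = _ at hg
  rw [h0, Limits.zero_comp] at hg
  rw [← cancel_epi (P.cochainComplexXIso _ 0 rfl).hom, ← hg, Limits.comp_zero]

/-- In either model the class vanishes exactly when the cocycle is a coboundary. -/
lemma Represents.eq_zero_iff (h : P.Represents f x) :
    x = 0 ↔ P.extMk f (n + 1) rfl h.cocycle = 0 := by
  have hc := h.cocycle
  obtain ⟨z, hz, hf⟩ := h
  have hinj : Function.Injective (P.isoExt (R := R) n Y).hom :=
    (ModuleCat.mono_iff_injective (P.isoExt (R := R) n Y).hom).1 inferInstance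
  have key : x = 0 ↔ (P.complex.linearYonedaObj R Y).homologyπ n z = 0 := by
    rw [← hinj.eq_iff, map_zero, hz]
  refine key.trans ?_
  cases n with
  | zero =>
    rw [extMk_zero_eq_zero_iff,
      (P.complex.linearYonedaObj R Y).homologyπ_eq_zero_iff (p := 0) (by simp), hf]
    -- In `ComplexShape.up ℕ` the predecessor of 0 is 0 itself, with zero differential.
    have h0 : (P.complex.linearYonedaObj R Y).d 0 0 = 0 :=
      HomologicalComplex.shape _ _ _ (by simp)
    simp only [h0]
    exact ⟨fun ⟨g, hg⟩ => hg.symm, fun h => ⟨0, h.symm⟩⟩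
  | succ p =>
    rw [P.extMk_eq_zero_iff _ _ _ _ p rfl,
      (P.complex.linearYonedaObj R Y).homologyπ_eq_zero_iff (p := p) (by simp), hf]
    rfl

lemma Represents.map {g : X' ⟶ X} (h : P.Represents f x) {P' : ProjectiveResolution X'}
    (φ : Hom P' P g) :
    P'.Represents (φ.hom.f n ≫ f) (((Ext R (ModuleCat.{u} R) n).map g.op).app Y x) := by
  obtain ⟨z, hz, rfl⟩ := h
  refine ⟨HomologicalComplex.cyclesMap (linearYonedaMap φ.hom Y) n z, ?_, ?_⟩
  · have h1 := ConcreteCategory.congr_hom (Ext_map_comp_isoExt_hom (R := R) g P P' φ n Y) x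
    have h2 := ConcreteCategory.congr_hom
      (HomologicalComplex.homologyπ_naturality (linearYonedaMap (R := R) φ.hom Y) n) z
    refine Eq.trans ?_ h1.symm
    refine h2.symm.trans ?_
    exact congrArg _ hz
  · exact ConcreteCategory.congr_hom
      (HomologicalComplex.cyclesMap_i (linearYonedaMap (R := R) φ.hom Y) n) z

/-- Both pullbacks precompose the cocycle with a lift of `g` to resolutions. Only vanishing has to
be transferred, so no isomorphism between the two theories is built. -/
lemma Represents.map_eq_zero_iff {g : X' ⟶ X} (h : P.Represents f x) :
    ((Ext R (ModuleCat.{u} R) n).map g.op).app Y x = 0 ↔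
    (Abelian.Ext.mk₀ g).comp (P.extMk f (n + 1) rfl h.cocycle) (zero_add n) = 0 := by
  let P' := projectiveResolution X'
  let φ : Hom P' P g := ⟨lift g P' P, (lift_commutes_zero g P' P).trans (by simp)⟩
  rw [mk₀_comp_extMk _ _ _ _ φ, (h.map φ).eq_zero_iff]

end
end CategoryTheory.ProjectiveResolution

/-! ### Local cohomology as a filtered colimit of Ext modules. -/

namespace BigradedCM

variable {S : Type u} [CommRing S]

lemma isZero_colimit_iff {J : Type w} [Category.{v} J] [IsFiltered J]
    {F : J ⥤ ModuleCat.{u} S} {D : Cocone F} [PreservesColimit F (forget (ModuleCat.{u} S))]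
    (hD : IsColimit D) :
    IsZero D.pt ↔ ∀ (j : J) (x : F.obj j), ∃ (j' : J) (f : j ⟶ j'), F.map f x = 0 := by
  rw [ModuleCat.isZero_iff_subsingleton]
  constructor
  · intro h j x
    obtain ⟨j', f, g, hg⟩ := Concrete.isColimit_exists_of_rep_eq (j := j) F hD x 0
      (Subsingleton.elim (α := D.pt) _ _)
    exact ⟨j', f, hg.trans (map_zero _)⟩
  · intro h
    refine ⟨fun a b => ?_⟩
    suffices H : ∀ a : D.pt, a = 0 by rw [H a, H b]
    intro a
    obtain ⟨j, x, rfl⟩ := Concrete.isColimit_exists_rep F hD a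
    obtain ⟨j', f, hf⟩ := h j x
    rw [← D.w f]
    change D.ι.app j' (F.map f x) = 0
    rw [hf, map_zero]

/-- The projection `S ⧸ J ⟶ S ⧸ I` for ideals `J ≤ I`. -/
def quotientTransition {I J : Ideal S} (h : J ≤ I) :
    ModuleCat.of S (S ⧸ J) ⟶ ModuleCat.of S (S ⧸ I) :=
  ModuleCat.ofHom (Submodule.mapQ J I LinearMap.id h)

lemma quotientTransition_comp {I J L : Ideal S} (h : J ≤ I) (h' : L ≤ J) :
    quotientTransition h' ≫ quotientTransition h = quotientTransition (h'.trans h) := by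
  ext
  rfl

/-- The pullback `Ext^i(S/I, M) → Ext^i(S/J, M)` for ideals `J ≤ I`. -/
noncomputable abbrev extTransition {I J : Ideal S} (h : J ≤ I) {M : ModuleCat.{u} S} {i : ℕ}
    (x : Abelian.Ext (ModuleCat.of S (S ⧸ I)) M i) : Abelian.Ext (ModuleCat.of S (S ⧸ J)) M i :=
  (Abelian.Ext.mk₀ (quotientTransition h)).comp x (zero_add i)

lemma extTransition_extTransition {I J L : Ideal S} (h : J ≤ I) (h' : L ≤ J) {M : ModuleCat.{u} S}
    {i : ℕ} (x : Abelian.Ext (ModuleCat.of S (S ⧸ I)) M i) :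
    extTransition h' (extTransition h x) = extTransition (h'.trans h) x := by
  simp only [extTransition, Abelian.Ext.mk₀_comp_mk₀_assoc, quotientTransition_comp]

instance preservesColimitsOfShape_forget_moduleCat :
    PreservesColimitsOfShape ℕᵒᵖᵒᵖ (forget (ModuleCat.{u} S)) := by
  have : PreservesFilteredColimitsOfSize.{0, 0} (forget (ModuleCat.{u} S)) :=
    preservesFilteredColimitsOfSize_shrink.{0, u, 0, u} _
  exact PreservesFilteredColimitsOfSize.preserves_filtered_colimits _

/-- The defining colimit of functors is evaluated at `M`; a filtered colimit is zero when each
element dies at a later stage. This moves the question to `Abelian.Ext`, where long exact sequences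
are used. -/
theorem localCohomologyVanishes_iff_pow (Q : Ideal S) (i : ℕ) (M : Type u) [AddCommGroup M]
    [Module S M] :
    LocalCohomologyVanishes Q i M ↔
      ∀ (k : ℕ) (x : Abelian.Ext (ModuleCat.of S (S ⧸ Q ^ k)) (ModuleCat.of S M) i),
        ∃ (l : ℕ) (h : k ≤ l), extTransition (Ideal.pow_le_pow_right h) x = 0 := by
  have := localCohomology.hasColimitDiagram.{u, 0} (localCohomology.idealPowersDiagram Q) i
  let hD := isColimitOfPreserves ((evaluation _ _).obj (ModuleCat.of S M))
    (colimit.isColimit (localCohomology.diagram (localCohomology.idealPowersDiagram Q) i))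
  refine (isZero_colimit_iff hD).trans ?_
  constructor
  · intro H k x
    let P := projectiveResolution (ModuleCat.of S (S ⧸ Q ^ k))
    obtain ⟨f, hf, rfl⟩ := P.extMk_surjective x (i + 1) rfl
    obtain ⟨y, hy⟩ := P.exists_represents_of_cocycle f hf
    obtain ⟨l, u, hu⟩ := H (.op (.op k)) y
    exact ⟨l.unop.unop, leOfHom u.unop.unop, (hy.map_eq_zero_iff).1 hu⟩
  · intro H j y
    obtain ⟨f, hy⟩ := ProjectiveResolution.exists_represents
      (projectiveResolution (ModuleCat.of S (S ⧸ Q ^ j.unop.unop))) y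
    obtain ⟨l, h, hl⟩ := H _ (ProjectiveResolution.extMk _ f (i + 1) rfl hy.cocycle)
    exact ⟨.op (.op l), (homOfLE h).op.op, (hy.map_eq_zero_iff).2 hl⟩

/-! ### Vanishing along short exact sequences. -/

section LongExactSequence

variable {Q : Ideal S} {M₁ M₂ M₃ : Type u} [AddCommGroup M₁] [Module S M₁] [AddCommGroup M₂]
  [Module S M₂] [AddCommGroup M₃] [Module S M₃]

/-- The short exact sequence of `ModuleCat` attached to an exact pair of linear maps. -/
lemma shortExact_moduleCat {f : M₁ →ₗ[S] M₂} {g : M₂ →ₗ[S] M₃} (hf : Function.Injective f)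
    (hg : Function.Surjective g) (hfg : Function.Exact f g) :
    (ShortComplex.mk (ModuleCat.ofHom f) (ModuleCat.ofHom g)
      (by ext x; exact hfg.apply_apply_eq_zero x)).ShortExact where
  exact := (ShortComplex.ShortExact.moduleCat_exact_iff_function_exact _).2 hfg
  mono_f := (ModuleCat.mono_iff_injective _).2 hf
  epi_g := (ModuleCat.epi_iff_surjective _).2 hg

lemma LocalCohomologyVanishes.of_subsingleton (Q : Ideal S) (i : ℕ) (M : Type u) [AddCommGroup M]
    [Module S M] [Subsingleton M] : LocalCohomologyVanishes Q i M := by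
  rw [localCohomologyVanishes_iff_pow]
  intro k x
  refine ⟨k, le_rfl, ?_⟩
  have h : 𝟙 (ModuleCat.of S M) = 0 := by ext y; exact Subsingleton.elim (α := M) _ _
  have : x = 0 := by rw [← x.comp_mk₀_id, h, Abelian.Ext.mk₀_zero, Abelian.Ext.comp_zero]
  rw [this, extTransition, Abelian.Ext.comp_zero]

/-- A power of `Q` kills the image in `M₃`; the class then lifts to `M₁`, and a higher power kills
the lift. -/
lemma LocalCohomologyVanishes.middle {f : M₁ →ₗ[S] M₂} {g : M₂ →ₗ[S] M₃}
    (hf : Function.Injective f) (hg : Function.Surjective g) (hfg : Function.Exact f g) {i : ℕ}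
    (h₁ : LocalCohomologyVanishes Q i M₁) (h₃ : LocalCohomologyVanishes Q i M₃) :
    LocalCohomologyVanishes Q i M₂ := by
  have hS := shortExact_moduleCat hf hg hfg
  rw [localCohomologyVanishes_iff_pow] at *
  intro k x
  obtain ⟨l, hl, h⟩ := h₃ k (x.comp (Abelian.Ext.mk₀ (ModuleCat.ofHom g)) (add_zero i))
  rw [extTransition, ← Abelian.Ext.comp_assoc _ _ _ (zero_add i) (add_zero i) (by simp)] at h
  obtain ⟨y, hy⟩ := Abelian.Ext.covariant_sequence_exact₂ _ hS _ h
  obtain ⟨l', hl', h'⟩ := h₁ l y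
  refine ⟨l', hl.trans hl', ?_⟩
  rw [← extTransition_extTransition (Ideal.pow_le_pow_right hl) (Ideal.pow_le_pow_right hl')]
  rw [extTransition, extTransition, ← hy,
    ← Abelian.Ext.comp_assoc _ _ _ (zero_add i) (add_zero i) (by simp), ← extTransition, h',
    Abelian.Ext.zero_comp]

lemma LocalCohomologyVanishes.right {f : M₁ →ₗ[S] M₂} {g : M₂ →ₗ[S] M₃}
    (hf : Function.Injective f) (hg : Function.Surjective g) (hfg : Function.Exact f g) {i : ℕ}
    (h₁ : LocalCohomologyVanishes Q (i + 1) M₁) (h₂ : LocalCohomologyVanishes Q i M₂) :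
    LocalCohomologyVanishes Q i M₃ := by
  have hS := shortExact_moduleCat hf hg hfg
  rw [localCohomologyVanishes_iff_pow] at *
  intro k x
  obtain ⟨l, hl, h⟩ := h₁ k (x.comp hS.extClass rfl)
  rw [extTransition, ← Abelian.Ext.comp_assoc _ _ _ (zero_add i) rfl (by simp)] at h
  obtain ⟨y, hy⟩ := Abelian.Ext.covariant_sequence_exact₃ _ hS _ rfl h
  obtain ⟨l', hl', h'⟩ := h₂ l y
  refine ⟨l', hl.trans hl', ?_⟩
  rw [← extTransition_extTransition (Ideal.pow_le_pow_right hl) (Ideal.pow_le_pow_right hl')]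
  rw [extTransition, extTransition, ← hy,
    ← Abelian.Ext.comp_assoc _ _ _ (zero_add i) (add_zero i) (by simp), ← extTransition, h',
    Abelian.Ext.zero_comp]

lemma LocalCohomologyVanishes.of_linearEquiv (e : M₁ ≃ₗ[S] M₂) {i : ℕ}
    (h : LocalCohomologyVanishes Q i M₁) : LocalCohomologyVanishes Q i M₂ :=
  IsZero.of_iso h ((localCohomology Q i).mapIso e.toModuleIso.symm)

/-- If the ideals of bounded projective dimension are cofinal with the powers of `Q`, then
local cohomology vanishes in large degrees. -/
lemma LocalCohomologyVanishes.of_hasProjectiveDimensionLT {n : ℕ}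
    (H : ∀ k, ∃ J : Ideal S, J ≤ Q ^ k ∧ (∃ l, Q ^ l ≤ J) ∧
      HasProjectiveDimensionLT (ModuleCat.of S (S ⧸ J)) n) {i : ℕ} (hi : n ≤ i)
    (M : Type u) [AddCommGroup M] [Module S M] : LocalCohomologyVanishes Q i M := by
  rw [localCohomologyVanishes_iff_pow]
  intro k x
  obtain ⟨J, hJ, ⟨l, hl⟩, hd⟩ := H k
  -- The class dies on S/J for degree reasons, hence also on S/Q^(k+l), which maps onto S/J.
  have h0 : extTransition hJ x = 0 := Abelian.Ext.eq_zero_of_hasProjectiveDimensionLT _ n hi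
  have hl' : Q ^ (k + l) ≤ J := (Ideal.pow_le_pow_right (Nat.le_add_left l k)).trans hl
  refine ⟨k + l, Nat.le_add_right k l, ?_⟩
  rw [← extTransition_extTransition hJ hl', h0, extTransition, Abelian.Ext.comp_zero]

end LongExactSequence

/-! ### Cohomological dimension and support. -/

section Support

variable {S : Type u} [CommRing S]

/-- A finite module over a noetherian ring whose support contains `p` has a nonzero quotient
that embeds into `S ⧸ p`. -/
lemma exists_injective_quotient_prime {M : Type v} [AddCommGroup M] [Module S M]
    [IsNoetherian S M] (p : Ideal S) [p.IsPrime] (hp : Module.annihilator S M ≤ p) :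
    ∃ (N : Submodule S M) (ψ : (M ⧸ N) →ₗ[S] S ⧸ p), Function.Injective ψ ∧ Nontrivial (M ⧸ N) := by
  obtain ⟨N, hN, hmax⟩ := WellFounded.has_min (wellFounded_gt (α := Submodule S M))
    {N | Module.annihilator S (M ⧸ N) ≤ p}
    ⟨⊥, (LinearEquiv.annihilator_eq
      (Submodule.quotEquivOfEqBot (⊥ : Submodule S M) rfl)).trans_le hp⟩
  -- Enlarging `N` by a lift of `x` must, by maximality, give a quotient killed by some `s` outside
  -- `p`.
  have key (x : M ⧸ N) (hx : x ≠ 0) : ∃ s ∉ p, ∀ y : M ⧸ N, s • y ∈ Submodule.span S {x} := by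
    have hlt : N < (Submodule.span S {x}).comap N.mkQ := by
      refine lt_of_le_of_ne (fun m hm => ?_) fun h => hx ?_
      · simp [(Submodule.Quotient.mk_eq_zero N).2 hm]
      · obtain ⟨m, rfl⟩ := N.mkQ_surjective x
        have : m ∈ N := by
          rw [h]
          exact Submodule.mem_span_singleton_self _
        simpa using this
    obtain ⟨s, hs, hsp⟩ := SetLike.not_le_iff_exists.1
      (fun h : Module.annihilator S _ ≤ p => hmax _ h hlt)
    refine ⟨s, hsp, fun y => ?_⟩
    obtain ⟨m, rfl⟩ := N.mkQ_surjective y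
    have h := Module.mem_annihilator.1 hs (Submodule.Quotient.mk m)
    rw [← Submodule.Quotient.mk_smul, Submodule.Quotient.mk_eq_zero] at h
    simpa using h
  have torsionFree (s : S) (hs : s ∉ p) (x : M ⧸ N) (hx : s • x = 0) : x = 0 := by
    by_contra h
    obtain ⟨t, ht, H⟩ := key x h
    have hst : s * t ∈ p := by
      refine hN (Module.mem_annihilator.2 fun y => ?_)
      obtain ⟨c, hc⟩ := Submodule.mem_span_singleton.1 (H y)
      rw [mul_smul, ← hc, smul_comm, hx, smul_zero]
    exact (Ideal.IsPrime.mem_or_mem ‹_› hst).elim hs ht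
  -- If az ≠ 0, then sz = caz for some s ∉ p; as s - ca ∉ p, this forces z = 0.
  have kill (a : S) (ha : a ∈ p) (z : M ⧸ N) : a • z = 0 := by
    by_contra h
    obtain ⟨s, hs, H⟩ := key _ h
    obtain ⟨c, hc⟩ := Submodule.mem_span_singleton.1 (H z)
    refine h ?_
    rw [torsionFree (s - c * a) (fun hm => hs ?_) z ?_, smul_zero]
    · rw [sub_smul, mul_smul, hc, sub_self]
    · simpa using add_mem hm (p.mul_mem_left c ha)
  have hnt : Nontrivial (M ⧸ N) := by
    by_contra h
    rw [not_nontrivial_iff_subsingleton] at h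
    exact (Ideal.ne_top_iff_one p).1 (Ideal.IsPrime.ne_top ‹_›)
      (hN (Module.mem_annihilator.2 fun y => Subsingleton.elim _ _))
  obtain ⟨x, hx⟩ := exists_ne (0 : M ⧸ N)
  obtain ⟨s, hs, H⟩ := key x hx
  have hker : LinearMap.ker (LinearMap.toSpanSingleton S (M ⧸ N) x) = p := by
    ext a
    rw [LinearMap.mem_ker, LinearMap.toSpanSingleton_apply]
    exact ⟨fun h => by_contra fun ha => hx (torsionFree a ha x h), fun ha => kill a ha x⟩
  let e : (S ⧸ p) ≃ₗ[S] Submodule.span S {x} :=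
    (Submodule.quotEquivOfEq _ _ hker.symm).trans
      ((LinearMap.quotKerEquivRange _).trans
        (LinearEquiv.ofEq _ _ (LinearMap.range_toSpanSingleton x)))
  -- Multiplication by `s` is injective and lands in Sx ≅ S/p.
  let φ : (M ⧸ N) →ₗ[S] Submodule.span S {x} := (LinearMap.lsmul S _ s).codRestrict _ H
  refine ⟨N, e.symm.toLinearMap ∘ₗ φ, e.symm.injective.comp ?_, hnt⟩
  rw [injective_iff_map_eq_zero]
  intro y hy
  exact torsionFree s hs y (congrArg Subtype.val hy)

variable [IsNoetherianRing S] {Q : Ideal S}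

/-- Vanishing of local cohomology of a finite module can be tested on the primes containing
the annihilator. -/
lemma LocalCohomologyVanishes.of_forall_isPrime {i : ℕ} (M : Type u) [AddCommGroup M] [Module S M]
    [Module.Finite S M]
    (h : ∀ p : Ideal S, p.IsPrime → Module.annihilator S M ≤ p →
      LocalCohomologyVanishes Q i (S ⧸ p)) :
    LocalCohomologyVanishes Q i M := by
  induction ‹Module.Finite S M› using
    IsNoetherianRing.induction_on_isQuotientEquivQuotientPrime S with
  | subsingleton N => exact .of_subsingleton _ _ _
  | quotient N p e =>
    refine (h p.1 p.2 ?_).of_linearEquiv e.symm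
    rw [e.annihilator_eq, Ideal.annihilator_quotient]
  | exact N₁ N₂ N₃ f g hf hg hfg h₁ h₃ =>
    exact .middle hf hg hfg
      (h₁ fun p hp hle => h p hp ((LinearMap.annihilator_le_of_injective f hf).trans hle))
      (h₃ fun p hp hle => h p hp ((LinearMap.annihilator_le_of_surjective g hg).trans hle))

/-- If the local cohomology of a finite module `M` vanishes in degrees at least `q`, then so does
that of every finite module whose support is contained in that of `M`. -/
theorem LocalCohomologyVanishes.of_annihilator_le {n : ℕ}
    (hn : ∀ i ≥ n, ∀ (N : Type u) [AddCommGroup N] [Module S N], LocalCohomologyVanishes Q i N)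
    {M : Type u} [AddCommGroup M] [Module S M] [Module.Finite S M] {q : ℕ}
    (hM : ∀ i ≥ q, LocalCohomologyVanishes Q i M)
    (N : Type u) [AddCommGroup N] [Module S N] [Module.Finite S N]
    (hMN : Module.annihilator S M ≤ Module.annihilator S N) {i : ℕ} (hi : q ≤ i) :
    LocalCohomologyVanishes Q i N := by
  -- Descending induction on `i`, with `d` bounding the distance to the range covered by `hn`.
  obtain ⟨d, hd⟩ : ∃ d, n ≤ i + d := ⟨n, Nat.le_add_left n i⟩
  induction d generalizing i N with
  | zero => exact hn i hd N
  | succ d ih =>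
    refine .of_forall_isPrime N fun p hp hle => ?_
    replace hle := hMN.trans hle
    clear hMN
    induction p using WellFoundedGT.induction with
    | ind p IH =>
    obtain ⟨L, ψ, hψ, hL⟩ := exists_injective_quotient_prime p hle
    -- H^i(M/L) lies between H^i(M) = 0 and H^(i+1)(L), which vanishes by the induction on degree.
    have h1 : LocalCohomologyVanishes Q i (M ⧸ L) :=
      .right L.injective_subtype L.mkQ_surjective (LinearMap.exact_subtype_mkQ L)
        (ih L (LinearMap.annihilator_le_of_injective _ L.injective_subtype) (by lia) (by lia))
        (hM i hi)
    refine .middle hψ (LinearMap.range ψ).mkQ_surjective (LinearMap.exact_map_mkQ_range ψ) h1 ?_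
    have hpC : p ≤ Module.annihilator S ((S ⧸ p) ⧸ LinearMap.range ψ) :=
      (Ideal.annihilator_quotient (I := p)).ge.trans
        (LinearMap.annihilator_le_of_surjective _ (LinearMap.range ψ).mkQ_surjective)
    -- The cokernel of `ψ` is supported on primes strictly above `p`: for y ≠ 0, a lift `c` of ψ(y)
    -- kills it, since zc = ψ(zy), yet c ∉ p.
    refine .of_forall_isPrime _ fun P hP hPC => IH P ?_ hP (hle.trans (hpC.trans hPC))
    refine lt_of_le_of_ne (hpC.trans hPC) ?_
    rintro rfl
    obtain ⟨y, hy⟩ := exists_ne (0 : M ⧸ L)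
    obtain ⟨c, hc⟩ := Submodule.Quotient.mk_surjective _ (ψ y)
    refine hy ((map_eq_zero_iff ψ hψ).1 ?_)
    rw [← hc, Submodule.Quotient.mk_eq_zero]
    refine hPC (Module.mem_annihilator.2 fun z => ?_)
    obtain ⟨z, rfl⟩ := Submodule.Quotient.mk_surjective _ z
    obtain ⟨z, rfl⟩ := Submodule.Quotient.mk_surjective _ z
    rw [← Submodule.Quotient.mk_smul, Submodule.Quotient.mk_eq_zero]
    refine ⟨z • y, ?_⟩
    rw [map_smul, ← hc, ← Submodule.Quotient.mk_smul, ← Submodule.Quotient.mk_smul, smul_eq_mul,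
      smul_eq_mul, mul_comm]

/-- A module that is Cohen-Macaulay with respect to `Q` and has nonnegative cohomological
dimension has exactly one nonzero local cohomology module. -/
lemma IsCMWrt.exists_cohomDim_eq {S : Type u} [CommRing S] {Q : Ideal S} {M : Type u}
    [AddCommGroup M] [Module S M] (h : IsCMWrt Q M) (h0 : 0 ≤ cohomDim Q M) :
    ∃ q : ℕ, cohomDim Q M = ((q : ℕ∞) : WithBot ℕ∞) ∧ ¬ LocalCohomologyVanishes Q q M ∧
      ∀ i ≠ q, LocalCohomologyVanishes Q i M := by
  have hex : ∃ q, ¬ LocalCohomologyVanishes Q q M := by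
    by_contra! H
    have : cohomDim Q M = ⊥ := by simp [cohomDim, H]
    rw [this] at h0
    exact absurd h0 (by decide)
  obtain ⟨q, hq⟩ := hex
  obtain ⟨q', H⟩ := h
  have hq' : (q : ℤ) = q' := by_contra fun hne => hq (H q hne)
  have hv : ∀ i ≠ q, LocalCohomologyVanishes Q i M := fun i hi => H i (by lia)
  refine ⟨q, le_antisymm (iSup₂_le fun i hi => ?_) (le_iSup₂_of_le q hq le_rfl), hq, hv⟩
  rw [by_contra fun hne => hi (hv i hne)]

/-- Over a noetherian ring with bounded local cohomology, a module which is sequentially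
Cohen-Macaulay and relatively unmixed with respect to `Q` is Cohen-Macaulay with respect to `Q`. -/
theorem isCMWrt_of_isSeqCMWrt_of_isRelativelyUnmixed {n : ℕ}
    (hn : ∀ i ≥ n, ∀ (N : Type u) [AddCommGroup N] [Module S N], LocalCohomologyVanishes Q i N)
    {M : Type u} [AddCommGroup M] [Module S M] [Module.Finite S M]
    {ι : Type*} [DecidableEq ι] (𝓜 : ι → AddSubgroup M) [DirectSum.Decomposition 𝓜]
    (hM : IsSeqCMWrt Q 𝓜) (hu : IsRelativelyUnmixed Q M) : IsCMWrt Q M := by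
  obtain ⟨r, F, hF, hCM, hnonneg, hmono⟩ := hM
  obtain _ | _ | r := r
  · have := hF.subsingleton
    exact ⟨0, fun i _ => .of_subsingleton _ _ _⟩
  · obtain ⟨e⟩ := hF.nonempty_linearEquiv
    obtain ⟨q, hq⟩ := hCM 0
    exact ⟨q, fun i hi => (hq i hi).of_linearEquiv e⟩
  · exfalso
    obtain ⟨f, hf⟩ := hF.exists_injective_first
    obtain ⟨g, hg⟩ := hF.exists_surjective_last
    have := hF.nontrivial_filtrationQuotient 0
    have : Module.Finite S (filtrationQuotient F 0) := Module.Finite.of_injective f hf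
    have : Module.Finite S (filtrationQuotient F (Fin.last (r + 1))) :=
      Module.Finite.of_surjective g hg
    obtain ⟨a, ha, -, hva⟩ := (hCM 0).exists_cohomDim_eq (hnonneg 0)
    obtain ⟨b, hb, hnb, -⟩ := (hCM (Fin.last (r + 1))).exists_cohomDim_eq (hnonneg _)
    have hab : a < b := by
      have h := hmono (show (0 : Fin (r + 2)) < Fin.last (r + 1) from Fin.last_pos)
      simp only [ha, hb] at h
      exact_mod_cast h
    obtain ⟨p, hp⟩ := associatedPrimes.nonempty S (filtrationQuotient F 0)
    obtain ⟨-, x, hx⟩ := (isAssociatedPrime_iff_exists_injective_linearMap _ _).1 hp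
    have hcd : cohomDim Q M ≤ ((a : ℕ∞) : WithBot ℕ∞) := by
      rw [hu p (associatedPrimes.subset_of_injective hf hp)]
      refine iSup₂_le fun i hi => ?_
      by_contra hlt
      -- Since S/p embeds in M₁, it inherits vanishing above degree `a`.
      refine hi (LocalCohomologyVanishes.of_annihilator_le hn (q := a + 1)
        (fun i hi => hva i (by lia)) (S ⧸ p) (LinearMap.annihilator_le_of_injective x hx) ?_)
      by_contra hia
      exact hlt (by exact_mod_cast (show i ≤ a by lia))
    refine hnb (LocalCohomologyVanishes.of_annihilator_le hn (q := a + 1) (M := M)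
      (fun i hi => ?_) _ (LinearMap.annihilator_le_of_surjective g hg) hab)
    by_contra h
    have := (le_iSup₂_of_le (f := fun (i : ℕ) (_ : ¬ LocalCohomologyVanishes Q i M) =>
      ((i : ℕ∞) : WithBot ℕ∞)) i h le_rfl).trans hcd
    have : i ≤ a := by exact_mod_cast this
    lia

end Support
-- Bounding local cohomology by powers of the variables.
section PowersOfVariables

variable {K : Type u} [Field K] {σ : Type}

/-- The ideal generated by the `l`-th powers of the variables indexed by `t`. -/
noncomputable def powIdeal (K : Type u) [Field K] {σ : Type} (l : ℕ) (t : Finset σ) :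
    Ideal (MvPolynomial σ K) :=
  Ideal.span ((fun j => MvPolynomial.X j ^ l) '' (t : Set σ))

lemma mem_powIdeal_iff {l : ℕ} {t : Finset σ} {f : MvPolynomial σ K} :
    f ∈ powIdeal K l t ↔ ∀ d ∈ f.support, ∃ j ∈ t, l ≤ d j := by
  have : (fun j => (MvPolynomial.X j : MvPolynomial σ K) ^ l) '' (t : Set σ) =
      (fun d => MvPolynomial.monomial d 1) '' ((fun j => Finsupp.single j l) '' (t : Set σ)) := by
    simp only [Set.image_image, MvPolynomial.X_pow_eq_monomial]
  rw [powIdeal, this, MvPolynomial.mem_ideal_span_monomial_image]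
  simp

/-- Membership is read off the exponents in `t`, which multiplication by a power of X_a leaves
alone. -/
lemma mem_powIdeal_of_mul_mem {l : ℕ} {t : Finset σ} {a : σ} (ha : a ∉ t) {f : MvPolynomial σ K}
    (hf : MvPolynomial.X a ^ l * f ∈ powIdeal K l t) : f ∈ powIdeal K l t := by
  rw [mem_powIdeal_iff] at *
  intro d hd
  obtain ⟨j, hj, hl⟩ := hf (Finsupp.single a l + d) (by
    rw [MvPolynomial.mem_support_iff] at hd ⊢
    rwa [MvPolynomial.X_pow_eq_monomial, MvPolynomial.coeff_monomial_mul, one_mul])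
  have : j ≠ a := fun h => ha (h ▸ hj)
  exact ⟨j, hj, by simpa [Finsupp.single_eq_of_ne this] using hl⟩

/-- Each new variable gives a short exact sequence whose injection is multiplication by X_a^l, so
the bound on projective dimension grows by one. -/
lemma hasProjectiveDimensionLT_quotient_powIdeal (l : ℕ) (t : Finset σ) :
    HasProjectiveDimensionLT
      (ModuleCat.of (MvPolynomial σ K) (MvPolynomial σ K ⧸ powIdeal K l t)) (t.card + 1) := by
  classical
  induction t using Finset.induction_on with
  | empty =>
    have h : powIdeal K l (∅ : Finset σ) = ⊥ := by simp [powIdeal]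
    have e : (MvPolynomial σ K ⧸ powIdeal K l (∅ : Finset σ)) ≃ₗ[MvPolynomial σ K]
      MvPolynomial σ K := Submodule.quotEquivOfEqBot _ h
    have : Module.Projective (MvPolynomial σ K) (MvPolynomial σ K ⧸ powIdeal K l (∅ : Finset σ)) :=
      Module.Projective.of_equiv e.symm
    have := (IsProjective.iff_projective (R := MvPolynomial σ K)
      (MvPolynomial σ K ⧸ powIdeal K l (∅ : Finset σ))).1 this
    change HasProjectiveDimensionLT _ 1
    infer_instance
  | insert a t ha ih =>
    have hle : powIdeal K l t ≤ powIdeal K l (insert a t) :=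
      Ideal.span_mono (Set.image_mono (by simp))
    let f : (MvPolynomial σ K ⧸ powIdeal K l t) →ₗ[MvPolynomial σ K]
        (MvPolynomial σ K ⧸ powIdeal K l t) := LinearMap.lsmul _ _ (MvPolynomial.X a ^ l)
    let g : (MvPolynomial σ K ⧸ powIdeal K l t) →ₗ[MvPolynomial σ K]
        (MvPolynomial σ K ⧸ powIdeal K l (insert a t)) := Submodule.factor hle
    have hf : Function.Injective f := by
      rw [injective_iff_map_eq_zero]
      intro x hx
      obtain ⟨x, rfl⟩ := Submodule.Quotient.mk_surjective _ x
      have hx' : Submodule.Quotient.mk (p := powIdeal K l t) (MvPolynomial.X a ^ l • x) = 0 := hx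
      rw [Submodule.Quotient.mk_eq_zero] at hx' ⊢
      exact mem_powIdeal_of_mul_mem ha hx'
    have hg : Function.Surjective g := Submodule.factor_surjective hle
    have hfg : Function.Exact f g := by
      intro x
      obtain ⟨x, rfl⟩ := Submodule.Quotient.mk_surjective _ x
      have hx : g (Submodule.Quotient.mk x) =
        Submodule.Quotient.mk (p := powIdeal K l (insert a t)) x := rfl
      rw [hx, Submodule.Quotient.mk_eq_zero]
      constructor
      · intro h
        rw [powIdeal, Finset.coe_insert, Set.image_insert_eq, Ideal.mem_span_insert] at h
        obtain ⟨c, z, hz, rfl⟩ := h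
        refine ⟨Submodule.Quotient.mk c, (Submodule.Quotient.eq _).2 ?_⟩
        change MvPolynomial.X a ^ l * c - (c * MvPolynomial.X a ^ l + z) ∈ powIdeal K l t
        rw [mul_comm, sub_add_cancel_left]
        exact neg_mem hz
      · rintro ⟨y, hy⟩
        obtain ⟨y, rfl⟩ := Submodule.Quotient.mk_surjective _ y
        have hy' : MvPolynomial.X a ^ l * y - x ∈ powIdeal K l t :=
          (Submodule.Quotient.eq _).1 hy
        have h1 : MvPolynomial.X a ^ l * y ∈ powIdeal K l (insert a t) :=
          Ideal.mul_mem_right _ _ (Ideal.subset_span ⟨a, by simp, rfl⟩)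
        have := sub_mem h1 (hle hy')
        rwa [sub_sub_cancel] at this
    rw [Finset.card_insert_of_notMem ha]
    exact (shortExact_moduleCat hf hg hfg).hasProjectiveDimensionLT_X₃ (t.card + 1) ih
      (hasProjectiveDimensionLT_of_ge _ (t.card + 1) _ (by lia))

/-- Local cohomology with support in `(y₁, …, y_n)` vanishes in degrees greater than `n`. -/
theorem localCohomologyVanishes_idealQ (K : Type u) [Field K] (m n : ℕ) {i : ℕ} (hi : n + 1 ≤ i)
    (M : Type u) [AddCommGroup M] [Module (BiPoly K m n) M] :
    LocalCohomologyVanishes (idealQ K m n) i M := by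
  let t : Finset (Fin m ⊕ Fin n) := Finset.univ.map Function.Embedding.inr
  have ht : t.card = n := by simp [t]
  refine LocalCohomologyVanishes.of_hasProjectiveDimensionLT (fun k => ?_) (ht ▸ hi) M
  -- The ideal (y₁^k, …, y_n^k) lies in Q^k and its radical contains `Q`, so these ideals are
  -- cofinal with the powers of `Q`.
  refine ⟨powIdeal K k t, ?_, ?_, hasProjectiveDimensionLT_quotient_powIdeal k t⟩
  · rw [powIdeal, Ideal.span_le]
    rintro _ ⟨j, hj, rfl⟩
    obtain ⟨j, -, rfl⟩ := Finset.mem_map.1 hj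
    have h : MvPolynomial.X (Sum.inr j) ∈ idealQ K m n := Ideal.subset_span ⟨j, rfl⟩
    exact Ideal.pow_mem_pow h k
  · refine Ideal.exists_pow_le_of_le_radical_of_fg ?_ (IsNoetherian.noetherian _)
    rw [idealQ, Ideal.span_le]
    rintro _ ⟨j, rfl⟩
    have h : MvPolynomial.X (Sum.inr j) ^ k ∈ powIdeal K k t :=
      Ideal.subset_span ⟨Sum.inr j, by simp [t], rfl⟩
    exact ⟨k, h⟩

end PowersOfVariables
end BigradedCM

theorem mainTheorem8 (K : Type u) [Field K] :
    (∀ (m n : ℕ) (M : Type u) [AddCommGroup M] [Module (BigradedCM.BiPoly K m n) M]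
        [Module.Finite (BigradedCM.BiPoly K m n) M]
        (𝓜 : ℤ × ℤ → AddSubgroup M) [DirectSum.Decomposition 𝓜]
        [SetLike.GradedSMul (BigradedCM.biPolyGrading K m n) 𝓜],
        BigradedCM.IsSeqCMWrt (BigradedCM.idealQ K m n) 𝓜 →
        BigradedCM.IsRelativelyUnmixed (BigradedCM.idealQ K m n) M →
        BigradedCM.IsCMWrt (BigradedCM.idealQ K m n) M) ∧
    (∀ (σ : Type v) [Finite σ] (M : Type w) [AddCommGroup M] [Module (MvPolynomial σ K) M]
        [Module.Finite (MvPolynomial σ K) M]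
        (𝓜 : ℤ → AddSubgroup M) [DirectSum.Decomposition 𝓜]
        [SetLike.GradedSMul (BigradedCM.stdGrading K σ) 𝓜],
        BigradedCM.IsSeqCM K σ 𝓜 →
        BigradedCM.IsUnmixed K σ M →
        BigradedCM.IsCM K σ M) := by
  refine ⟨?_, ?_⟩
  · intro m n M _ _ _ 𝓜 _ _ hM hu
    exact BigradedCM.isCMWrt_of_isSeqCMWrt_of_isRelativelyUnmixed
      (fun i hi N => BigradedCM.localCohomologyVanishes_idealQ K m n hi N) 𝓜 hM hu
  · intro σ _ M _ _ _ 𝓜 _ _ hM hu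
    exact BigradedCM.isCM_of_isSeqCM_of_isUnmixed 𝓜 hM hu
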